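/- Let $B\subset\mathbb{R}^d$ be a bounded Borel set of positive Lebesgue measure, and let $\mathbf N$ be the space of integer-valued finite measures $x$ on $B$ with the smallest $\sigma$-algebra making all maps $x\mapsto x(A)$, $A\subset B$ Borel, measurable. Let $\eta$ be a Poisson point process on $B$ with finite atomless intensity measure $\lambda$ and distribution $P_\eta$ on $\mathbf N$, and let $\mu$ be a point process on $B$ with distribution $dP_\mu=p\,dP_\eta$, where $p:\mathbf N\to[0,\infty)$ is measurable, $\int p\,dP_\eta=1$, $p\in L_2(P_\eta)$, and $p$ is hereditary: $p(x)>0$ implies $p(\tilde x)>0$ for all $\tilde x\subset x$. For $n\ge 1$ and $u_1,\dots,u_n\in B$ let $$\lambda^*_n(u_1,\dots,u_n;x)=\frac{p(x\cup\{u_1,\dots,u_n\})}{p(x)}\quad\text{if }p(x)>0,\qquad \lambda^*_n(u_1,\dots,u_n;x)=0\quad\text{if }p(x)=0,$$ where $x\cup\{u_1,\dots,u_n\}$ stands for $x+\delta_{u_1}+\dots+\delta_{u_n}$, and let $\lambda^*_0\equiv 1$ ($\lambda^*_n$ is the conditional intensity of order $n$ of $\mu$). Let $m\in\mathbb N$ and,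 for $i=1,\dots,m$, let $F_i$ be the $U$-statistic of order $k_i$ driven by $f_i$, that is, $$F_i(x)=\sum_{(x_1,\dots,x_{k_i})\in x^{k_i}_{\neq}}f_i(x_1,\dots,x_{k_i}),\qquad x\in\mathbf N,$$ the sum being over all $k_i$-tuples of pairwise different points of $x$, where $f_i:B^{k_i}\to[0,\infty)$ is measurable, symmetric in its variables and in $L_1(\lambda^{k_i})$. Suppose that $\prod_{i=1}^mF_i\in L_2(P_\eta)$. Put $k=k_1+\dots+k_m$ and $J_i=\{j:k_1+\dots+k_{i-1}<j\le k_1+\dots+k_i\}$, and let $\Pi_{k_1\dots k_m}$ be the set of all partitions $\sigma$ of $\{1,\dots,k\}$ such that every block of $\sigma$ has at most one element in common with each $J_i$. For such $\sigma$, with $|\sigma|$ blocks, let $(\otimes_{i=1}^mf_i)_\sigma:B^{|\sigma|}\to[0,\infty)$ be obtained from the tensor product $\otimes_{i=1}^mf_i$ on $B^k$ by replacing all variables whose indices belong to the same block of $\sigma$ by one new common variable. Then $\prod_{i=1}^mF_i(\mu)$ is integrable; for every $\sigma\in\Pi_{k_1\dots k_m}$ the expectation $\mathbb E\lambda^*_{|\sigma|}(x_1,\dots,x_{|\sigma|};\mu)$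 is finite for $\lambda^{|\sigma|}$-almost all $(x_1,\dots,x_{|\sigma|})$, and $(\otimes_{i=1}^mf_i)_\sigma\,\mathbb E\lambda^*_{|\sigma|}(\,\cdot\,;\mu)$ is $\lambda^{|\sigma|}$-integrable; and $$\mathbb E\prod_{i=1}^mF_i(\mu)=\sum_{\sigma\in\Pi_{k_1\dots k_m}}\int_{B^{|\sigma|}}(\otimes_{i=1}^mf_i)_\sigma(x_1,\dots,x_{|\sigma|})\,\mathbb E\lambda^*_{|\sigma|}(x_1,\dots,x_{|\sigma|};\mu)\,\lambda(d(x_1,\dots,x_{|\sigma|})).$$ -/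

import Mathlib

open MeasureTheory ProbabilityTheory
open scoped NNReal ENNReal

namespace PointProcess

/-- Integer-valued finite measures (point configurations) on `E`. As a subtype of `Measure E` it
carries the smallest `σ`-algebra that makes `x ↦ x A` measurable for every measurable `A`. -/
abbrev Config (E : Type*) [MeasurableSpace E] : Type _ :=
  {x : Measure E // ∀ A : Set E, MeasurableSet A → ∃ n : ℕ, x A = n}

theorem finite_atoms {E : Type*} [MeasurableSpace E] [MeasurableSingletonClass E] (x : Config E) :
    {u : E | x.1 {u} ≠ 0}.Finite := by
  have hfin : x.1 Set.univ ≠ ∞ := by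
    obtain ⟨N, hN⟩ := x.2 Set.univ MeasurableSet.univ
    simp [hN]
  have h := Measure.finite_const_le_meas_of_disjoint_iUnion x.1 (ε := 1) one_pos
    (As := fun u : E => ({u} : Set E)) (fun u => measurableSet_singleton u)
    (fun u v huv => by simpa [Function.onFun] using huv)
    (ne_top_of_le_ne_top hfin (measure_mono (Set.subset_univ _)))
  refine h.subset fun u hu => ?_
  obtain ⟨n, hn⟩ := x.2 {u} (measurableSet_singleton u)
  simp only [Set.mem_ofPred_eq, hn] at hu ⊢
  exact_mod_cast Nat.one_le_iff_ne_zero.2 (by exact_mod_cast hu)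

/-- The finite set of points of a configuration. -/
noncomputable def points {E : Type*} [MeasurableSpace E] [MeasurableSingletonClass E]
    (x : Config E) : Finset E :=
  (finite_atoms x).toFinset

open Classical in
/-- The set `x^k_≠` of `k`-tuples of different points of the configuration `x`. -/
noncomputable def distinctTuples {E : Type*} [MeasurableSpace E] [MeasurableSingletonClass E]
    (k : ℕ) (x : Config E) : Finset (Fin k → E) :=
  (Fintype.piFinset fun _ : Fin k => points x).filter Function.Injective

/-- The configuration `x ∪ {u_i : i ∈ ι}`, that is, `x + ∑ i, δ_{u_i}`. -/
noncomputable def addPoints {E : Type*} [MeasurableSpace E] {ι : Type*} [Fintype ι]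
    (x : Config E) (u : ι → E) : Config E :=
  ⟨x.1 + ∑ i, Measure.dirac (u i), fun A hA => by
    classical
    obtain ⟨n, hn⟩ := x.2 A hA
    refine ⟨n + ∑ i, if u i ∈ A then 1 else 0, ?_⟩
    simp [hn, Measure.dirac_apply' _ hA, Set.indicator_apply]⟩

/-- `Q` is the distribution of a Poisson point process with (finite) intensity measure `lam`:
counts of measurable sets are Poisson distributed, and counts of pairwise disjoint measurable sets
are independent. -/
structure IsPoissonLaw {E : Type*} [MeasurableSpace E] (lam : Measure E)
    (Q : Measure (Config E)) : Prop where
  count_law : ∀ A : Set E, MeasurableSet A →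
    Q.map (fun x : Config E => x.1 A) =
      (poissonMeasure (lam A).toNNReal).map (fun n : ℕ => (n : ℝ≥0∞))
  indep : ∀ (r : ℕ) (A : Fin r → Set E), (∀ i, MeasurableSet (A i)) →
    Pairwise (fun i j => Disjoint (A i) (A j)) →
    iIndepFun (fun (i : Fin r) (x : Config E) => x.1 (A i)) Q

/-- `F` is the `U`-statistic of order `k` driven by the symmetric function `f ∈ L₁(lam^k)`. -/
structure IsUStatistic {E : Type*} [MeasurableSpace E] [MeasurableSingletonClass E]
    (lam : Measure E) (k : ℕ) (f : (Fin k → E) → ℝ) (F : Config E → ℝ) : Prop where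
  measurable : Measurable f
  symmetric : ∀ (q : Equiv.Perm (Fin k)) (u : Fin k → E), f (u ∘ q) = f u
  integrable : Integrable f (Measure.pi fun _ : Fin k => lam)
  eq_sum : ∀ x : Config E, F x = ∑ u ∈ distinctTuples k x, f u

/-- A density is hereditary if it is positive at every sub-configuration of a configuration at
which it is positive. -/
def Hereditary {E : Type*} [MeasurableSpace E] (p : Config E → ℝ≥0) : Prop :=
  ∀ x y : Config E, y.1 ≤ x.1 → 0 < p x → 0 < p y

open Classical in
/-- The conditional intensity `λ*_n(u; x) = p(x ∪ {u_1, …, u_n}) / p(x)` of order `n = |ι|`, for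
points `u` indexed by a finite type `ι`. It is `0` if `p x = 0` (division by zero), and it is `1`
for `n = 0`. -/
noncomputable def condIntensity {E : Type*} [MeasurableSpace E] {ι : Type*} [Fintype ι]
    (p : Config E → ℝ≥0) (u : ι → E) (x : Config E) : ℝ :=
  if IsEmpty ι then 1 else (p (addPoints x u) : ℝ) / (p x : ℝ)

/-- The index set of the `k_1 + ⋯ + k_m` variables of the tensor product of functions with
`k_1, …, k_m` variables: `⟨i, j⟩` is the `j`-th variable of the `i`-th function. -/
abbrev Vars {m : ℕ} (k : Fin m → ℕ) : Type := (i : Fin m) × Fin (k i)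

/-- The set `Π_{k_1 … k_m}` of all partitions of the variables each of whose blocks has at most one
element in common with every `J_i`, the set of variables of the `i`-th function. -/
def diagramPartitions {m : ℕ} (k : Fin m → ℕ) :
    Finset (Finpartition (Finset.univ : Finset (Vars k))) :=
  Finset.univ.filter fun σ => ∀ i : Fin m, ∀ b ∈ σ.parts, (b.filter fun a => a.1 = i).card ≤ 1

/-- The block of `σ` that contains the variable `a`. -/
def blockOf {m : ℕ} {k : Fin m → ℕ} (σ : Finpartition (Finset.univ : Finset (Vars k)))
    (a : Vars k) : {b // b ∈ σ.parts} :=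
  ⟨σ.part a, σ.part_mem.2 (Finset.mem_univ a)⟩

/-- The function `(f_1 ⊗ ⋯ ⊗ f_m)_σ` of `|σ|` variables: all variables of the tensor product in the
same block of `σ` are replaced by one new variable. The new variables are indexed by the blocks. -/
def contractedTensor {E : Type*} {m : ℕ} {k : Fin m → ℕ} (f : (i : Fin m) → (Fin (k i) → E) → ℝ)
    (σ : Finpartition (Finset.univ : Finset (Vars k))) (x : {b // b ∈ σ.parts} → E) : ℝ :=
  ∏ i, f i fun j => x (blockOf σ ⟨i, j⟩)

end PointProcess

namespace PointProcess

/-! ### Measurability on the space of configurations -/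

section Measurability

variable {E : Type*} [MeasurableSpace E]

/-! Everything rests on the multivariate Mecke formula for the Poisson process
(`IsPoissonLaw.mecke_fintype`): the mean of a sum of `G (u, x)` over tuples of different points of
`x` is the integral over `u` against the product of `lam` of the mean of `G (u, addPoints x u)`.

A product of `U`-statistics is a sum over one tuple of points for each factor. The coincidences
between these tuples define a partition of all the variables, and points within one tuple differ, so
exactly the diagram partitions occur. Grouping by partition gives sums over tuples of different
points, one point per block (`prod_sum_distinctTuples`). Multiplying by `p` and applying Mecke to
each of them leaves the integral of the contracted tensor against the `Q`-mean of `p (addPoints x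
v)`. By heredity this mean is the expected conditional intensity (`Hereditary.mul_condIntensity`).

Since the `f i` are nonnegative, all identities hold in `ℝ≥0∞` without integrability conditions.
Finiteness enters only at the end: Hölder's inequality for `p` and the product of the `F i` makes
the whole sum finite. The expected conditional intensities are almost everywhere finite for a
separate reason: Poisson moments and `p ∈ L₂` (`IsPoissonLaw.ae_lintegral_addPoints_lt_top`).

The Mecke formula itself is derived from the Poisson counts and their independence alone. The
identity `n · Poi(r)(n) = r · Poi(r)(n - 1)` yields it for disjoint counts, then for arbitrary
finite families of counts, and a π-system argument extends it to all events. -/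

theorem measurable_count {A : Set E} (hA : MeasurableSet A) :
    Measurable fun x : Config E => x.1 A :=
  (Measure.measurable_coe hA).comp measurable_subtype_coe

theorem measurable_config_of_count {α : Type*} [MeasurableSpace α] {g : α → Config E}
    (hg : ∀ A, MeasurableSet A → Measurable fun a => (g a).1 A) : Measurable g :=
  Measurable.subtype_mk (f := fun a => (g a).1) (Measure.measurable_of_measurable_coe _ hg)

theorem count_ne_top (x : Config E) (A : Set E) : x.1 A ≠ ∞ := by
  obtain ⟨n, hn⟩ := x.2 Set.univ MeasurableSet.univ
  exact ne_top_of_le_ne_top (by simp [hn]) (measure_mono (Set.subset_univ A))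

instance isFiniteMeasure_config (x : Config E) : IsFiniteMeasure x.1 :=
  ⟨(count_ne_top x _).lt_top⟩

theorem coe_addPoints {ι : Type*} [Fintype ι] (x : Config E) (u : ι → E) :
    (addPoints x u).1 = x.1 + ∑ i, Measure.dirac (u i) := rfl

theorem addPoints_apply {ι : Type*} [Fintype ι] (x : Config E) (u : ι → E) {A : Set E}
    (hA : MeasurableSet A) :
    (addPoints x u).1 A = x.1 A + ∑ i, A.indicator 1 (u i) := by
  simp [coe_addPoints, Measure.dirac_apply' _ hA]

theorem measurable_addPoints {ι : Type*} [Fintype ι] :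
    Measurable fun q : Config E × (ι → E) => addPoints q.1 q.2 := by
  refine measurable_config_of_count fun A hA => ?_
  simp_rw [addPoints_apply _ _ hA]
  refine ((measurable_count hA).comp measurable_fst).add (Finset.measurable_fun_sum _ fun i _ => ?_)
  exact (measurable_one.indicator hA).comp ((measurable_pi_apply i).comp measurable_snd)

/-- The configuration `x + δ_u`. -/
noncomputable def addPoint (x : Config E) (u : E) : Config E := addPoints x fun _ : Unit => u

theorem coe_addPoint (x : Config E) (u : E) : (addPoint x u).1 = x.1 + Measure.dirac u := by
  simp [addPoint, coe_addPoints]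

theorem addPoint_apply (x : Config E) (u : E) {A : Set E} (hA : MeasurableSet A) :
    (addPoint x u).1 A = x.1 A + A.indicator 1 u := by
  simp [coe_addPoint, Measure.dirac_apply' _ hA]

theorem measurable_addPoint : Measurable fun q : Config E × E => addPoint q.1 q.2 :=
  measurable_addPoints.comp (measurable_fst.prodMk (measurable_pi_lambda _ fun _ => measurable_snd))

theorem addPoint_addPoints {k : ℕ} (x : Config E) (u₀ : E) (u : Fin k → E) :
    addPoint (addPoints x u) u₀ = addPoints x (Fin.cons u₀ u : Fin (k + 1) → E) := by
  refine Subtype.ext ?_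
  simp only [coe_addPoint, coe_addPoints, Fin.sum_univ_succ, Fin.cons_zero, Fin.cons_succ]
  abel

/-- The kernel that maps a configuration to itself, as a measure. -/
noncomputable def configKernel (E : Type*) [MeasurableSpace E] : Kernel (Config E) E :=
  ⟨Subtype.val, measurable_subtype_coe⟩

theorem configKernel_apply (x : Config E) : configKernel E x = x.1 := rfl

/-- Each configuration has finite mass, but the masses have no common bound; cutting the space by
the integer total mass gives countably many finite kernels. -/
instance isSFiniteKernel_configKernel : IsSFiniteKernel (configKernel E) := by
  classical
  have hs : ∀ n : ℕ, MeasurableSet {x : Config E | x.1 Set.univ = n} := fun n =>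
    measurable_count MeasurableSet.univ (measurableSet_singleton _)
  have hsum : configKernel E = Kernel.sum fun n : ℕ => Kernel.piecewise (hs n) (configKernel E) 0 := by
    ext x A hA
    obtain ⟨N, hN⟩ := x.2 Set.univ MeasurableSet.univ
    rw [Kernel.sum_apply' _ _ hA, tsum_eq_single N]
    · simp [Kernel.piecewise_apply, hN]
    · intro n hn
      have : x ∉ {x : Config E | x.1 Set.univ = n} := fun h => hn (by
        have := (show x.1 Set.univ = n from h).symm.trans hN
        exact_mod_cast this)
      simp [Kernel.piecewise_apply, this]
  rw [hsum]
  have : ∀ n : ℕ, IsFiniteKernel (Kernel.piecewise (hs n) (configKernel E) 0) := fun n =>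
    ⟨n, by simp, fun x => by
      by_cases h : x.1 Set.univ = n <;> simp [Kernel.piecewise_apply, configKernel_apply, h]⟩
  infer_instance

theorem measurable_lintegral_config {T : Type*} [MeasurableSpace T] {h : E → T × Config E → ℝ≥0∞}
    (hh : Measurable fun q : E × (T × Config E) => h q.1 q.2) :
    Measurable fun q : T × Config E => ∫⁻ u, h u q ∂q.2.1 := by
  have := Measurable.lintegral_kernel_prod_right (κ := (configKernel E).comap
    (Prod.snd : T × Config E → Config E) measurable_snd) (f := fun q u => h u q)
    (hh.comp measurable_swap)
  exact this

/-- The `σ`-algebra of configurations is generated by the events determined by finitely many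
counts. -/
theorem config_measurableSpace_eq_generateFrom :
    (inferInstance : MeasurableSpace (Config E)) = MeasurableSpace.generateFrom
      (piiUnionInter (fun A : {A : Set E // MeasurableSet A} =>
        {s : Set (Config E) | MeasurableSet[(borel ℝ≥0∞).comap fun x : Config E => x.1 A.1] s})
        Set.univ) := by
  refine Eq.trans ?_ (generateFrom_piiUnionInter_measurableSet
    (fun A : {A : Set E // MeasurableSet A} => (borel ℝ≥0∞).comap fun x : Config E => x.1 A.1)
    Set.univ).symm
  simp only [Set.mem_univ, iSup_pos]
  change MeasurableSpace.comap _ Measure.instMeasurableSpace = _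
  rw [Measure.instMeasurableSpace]
  simp only [MeasurableSpace.comap_iSup, MeasurableSpace.comap_comp, iSup_subtype]
  rfl

end Measurability

/-! ### The one-point Mecke formula -/

section Poisson

theorem lintegral_poissonMeasure (r : ℝ≥0) (g : ℕ → ℝ≥0∞) :
    ∫⁻ n, g n ∂poissonMeasure r =
      ∑' n : ℕ, g n * ENNReal.ofReal (Real.exp (-r) * r ^ n / n.factorial) := by
  simp_rw [lintegral_countable', poissonMeasure_singleton]

/-- The factor `n` cancels against `n!` and kills the term `n = 0`, so the index shifts by one. This
is the Mecke formula in its smallest form. -/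
theorem lintegral_nat_mul_poissonMeasure (r : ℝ≥0) (g : ℕ → ℝ≥0∞) :
    ∫⁻ n, n * g n ∂poissonMeasure r = r * ∫⁻ n, g (n + 1) ∂poissonMeasure r := by
  rw [lintegral_poissonMeasure, lintegral_poissonMeasure, tsum_eq_zero_add' ENNReal.summable,
    ← ENNReal.tsum_mul_left]
  simp only [Nat.cast_zero, zero_mul, zero_add]
  refine tsum_congr fun n => ?_
  have : (r : ℝ≥0∞) * ENNReal.ofReal (Real.exp (-r) * r ^ n / n.factorial) =
      ((n + 1 : ℕ) : ℝ≥0∞) * ENNReal.ofReal (Real.exp (-r) * r ^ (n + 1) / (n + 1).factorial) := by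
    rw [← ENNReal.ofReal_natCast, ← ENNReal.ofReal_coe_nnreal, ← ENNReal.ofReal_mul (by positivity),
      ← ENNReal.ofReal_mul (by positivity)]
    congr 1
    rw [Nat.factorial_succ]
    push_cast
    field_simp
    ring
  rw [mul_left_comm, this]
  ring

variable {E : Type*} [MeasurableSpace E] {lam : Measure E} {Q : Measure (Config E)}

theorem IsPoissonLaw.isProbabilityMeasure (hQ : IsPoissonLaw lam Q) : IsProbabilityMeasure Q := by
  have h := congrArg (fun m => m Set.univ) (hQ.count_law ∅ MeasurableSet.empty)
  simp only [Measure.map_apply (measurable_count MeasurableSet.empty) MeasurableSet.univ,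
    Measure.map_apply (measurable_of_countable (fun n : ℕ => (n : ℝ≥0∞))) MeasurableSet.univ,
    Set.preimage_univ, measure_univ] at h
  exact ⟨h⟩

theorem IsPoissonLaw.lintegral_count (hQ : IsPoissonLaw lam Q) {A : Set E} (hA : MeasurableSet A)
    {g : ℝ≥0∞ → ℝ≥0∞} (hg : Measurable g) :
    ∫⁻ x, g (x.1 A) ∂Q = ∫⁻ n : ℕ, g n ∂poissonMeasure (lam A).toNNReal := by
  rw [← lintegral_map hg (measurable_count hA), hQ.count_law A hA,
    lintegral_map hg (measurable_of_countable _)]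

theorem IsPoissonLaw.map_counts (hQ : IsPoissonLaw lam Q) {ι : Type*} [Fintype ι] {A : ι → Set E}
    (hA : ∀ i, MeasurableSet (A i)) (hd : Pairwise fun i j => Disjoint (A i) (A j)) :
    Q.map (fun x i => x.1 (A i)) = Measure.pi fun i =>
      (poissonMeasure (lam (A i)).toNNReal).map (fun n : ℕ => (n : ℝ≥0∞)) := by
  have := hQ.isProbabilityMeasure
  let e := Fintype.equivFin ι
  have h := (hQ.indep _ (fun j => A (e.symm j)) (fun j => hA _)
    (fun i j hij => hd (e.symm.injective.ne hij))).precomp e.injective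
  simp only [Equiv.symm_apply_apply] at h
  rw [(iIndepFun_iff_map_fun_eq_pi_map fun i => (measurable_count (hA i)).aemeasurable).1 h]
  simp_rw [hQ.count_law _ (hA _)]

/-- By independence the counts have a product law, so the one-dimensional Poisson shift can be
applied in coordinate `b` with the other coordinates frozen. -/
theorem IsPoissonLaw.lintegral_count_mul_of_disjoint [IsFiniteMeasure lam]
    (hQ : IsPoissonLaw lam Q) {ι : Type*} [Fintype ι] [DecidableEq ι] {A : ι → Set E}
    (hA : ∀ i, MeasurableSet (A i)) (hd : Pairwise fun i j => Disjoint (A i) (A j)) (b : ι)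
    {Φ : (ι → ℝ≥0∞) → ℝ≥0∞} (hΦ : Measurable Φ) :
    ∫⁻ x, x.1 (A b) * Φ (fun i => x.1 (A i)) ∂Q =
      lam (A b) * ∫⁻ x, Φ (fun i => x.1 (A i) + if i = b then 1 else 0) ∂Q := by
  have hm : Measurable fun (x : Config E) i => x.1 (A i) :=
    measurable_pi_lambda _ fun i => measurable_count (hA i)
  have hshift : Measurable fun (y : ι → ℝ≥0∞) i => y i + if i = b then 1 else 0 := by
    refine measurable_pi_lambda _ fun i => ?_
    exact (measurable_pi_apply i).add_const _
  have h1 : Measurable fun y : ι → ℝ≥0∞ => y b * Φ y := (measurable_pi_apply b).mul hΦ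
  have h2 : Measurable fun y : ι → ℝ≥0∞ =>
      lam (A b) * Φ (fun i => y i + if i = b then 1 else 0) := (hΦ.comp hshift).const_mul _
  have h3 : Measurable fun x : Config E => Φ (fun i => x.1 (A i) + if i = b then 1 else 0) :=
    hΦ.comp (hshift.comp hm)
  rw [← lintegral_const_mul _ h3,
    ← lintegral_map (f := fun y : ι → ℝ≥0∞ => y b * Φ y) h1 hm,
    ← lintegral_map (f := fun y : ι → ℝ≥0∞ =>
      lam (A b) * Φ (fun i => y i + if i = b then 1 else 0)) h2 hm, hQ.map_counts hA hd]
  -- It suffices to compare the integrals over the single coordinate `b`.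
  refine lintegral_eq_of_lmarginal_eq {b} h1 h2 ?_
  rw [lmarginal_singleton, lmarginal_singleton]
  funext y
  have hu : Measurable fun t : ℝ≥0∞ => Function.update y b t := measurable_update y
  refine (lintegral_map (h1.comp hu) (measurable_of_countable _)).trans
    (Eq.trans ?_ (lintegral_map (h2.comp hu) (measurable_of_countable _)).symm)
  simp only [Function.comp_apply, Function.update_self]
  rw [lintegral_nat_mul_poissonMeasure _ fun n => Φ (Function.update y b n),
    ENNReal.coe_toNNReal (measure_ne_top _ _), ← lintegral_const_mul _ (measurable_of_countable _)]
  refine lintegral_congr fun n => ?_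
  congr 2
  funext i
  by_cases hi : i = b
  · subst hi; simp
  · simp [hi]

/-- Overlapping sets are cut into the cells of the finite algebra they generate. These are disjoint,
every count is a sum of cell counts, and the disjoint case applies to each cell inside `A b`. -/
theorem IsPoissonLaw.lintegral_count_mul [IsFiniteMeasure lam]
    (hQ : IsPoissonLaw lam Q) {ι : Type*} [Fintype ι] {A : ι → Set E}
    (hA : ∀ i, MeasurableSet (A i)) (b : ι) {Ψ : (ι → ℝ≥0∞) → ℝ≥0∞} (hΨ : Measurable Ψ) :
    ∫⁻ x, x.1 (A b) * Ψ (fun i => x.1 (A i)) ∂Q =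
      ∫⁻ x, ∫⁻ u in A b, Ψ (fun i => (addPoint x u).1 (A i)) ∂lam ∂Q := by
  classical
  have := hQ.isProbabilityMeasure
  -- The cell of the points that lie in `A i` for exactly the indices `i ∈ s`.
  let C : Finset ι → Set E := fun s => ⋂ i, if i ∈ s then A i else (A i)ᶜ
  have memC : ∀ s u, u ∈ C s ↔ ∀ i, u ∈ A i ↔ i ∈ s := by
    intro s u
    simp only [C, Set.mem_iInter]
    refine forall_congr' fun i => ?_
    by_cases h : i ∈ s <;> simp [h]
  have hC : ∀ s, MeasurableSet (C s) := fun s => MeasurableSet.iInter fun i => by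
    by_cases h : i ∈ s <;> simp [h, hA i]
  have hd : Pairwise fun s t => Disjoint (C s) (C t) := fun s t hst =>
    Set.disjoint_left.2 fun u hu hu' => hst (Finset.ext fun i =>
      ((memC s u).1 hu i).symm.trans ((memC t u).1 hu' i))
  have hAC : ∀ i, A i = ⋃ s ∈ Finset.univ.filter (fun s : Finset ι => i ∈ s), C s := by
    intro i
    ext u
    simp only [Finset.mem_filter, Finset.mem_univ, true_and, Set.mem_iUnion, exists_prop]
    refine ⟨fun hu => ⟨Finset.univ.filter fun j => u ∈ A j, by simpa using hu,
      (memC _ u).2 fun j => by simp⟩, ?_⟩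
    rintro ⟨s, his, hus⟩
    exact ((memC s u).1 hus i).2 his
  have hdi : ∀ i, (↑(Finset.univ.filter fun s : Finset ι => i ∈ s) : Set (Finset ι)).PairwiseDisjoint
      C := fun i s _ t _ hst => hd hst
  have hsum : ∀ (x : Config E) i, x.1 (A i) = ∑ s with i ∈ s, x.1 (C s) := fun x i => by
    conv_lhs => rw [hAC i]
    exact measure_biUnion_finset (hdi i) fun s _ => hC s
  let T : (Finset ι → ℝ≥0∞) → ι → ℝ≥0∞ := fun y i => ∑ s with i ∈ s, y s
  have hT : Measurable T := measurable_pi_lambda _ fun i =>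
    Finset.measurable_fun_sum _ fun s _ => measurable_pi_apply s
  have hTx : ∀ x : Config E, (fun i => x.1 (A i)) = T fun s => x.1 (C s) := fun x =>
    funext fun i => hsum x i
  -- A new point in the cell `C s` affects the counts only through the count of that cell, whatever
  -- its position there.
  have hTadd : ∀ (x : Config E) (s : Finset ι), ∀ u ∈ C s, (fun i => (addPoint x u).1 (A i)) =
      T fun t => x.1 (C t) + if t = s then 1 else 0 := by
    intro x s u hu
    funext i
    simp only [T]
    rw [addPoint_apply _ _ (hA i), hsum, Finset.sum_add_distrib, Finset.sum_ite_eq']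
    congr 1
    by_cases h : i ∈ s
    · simp [h, ((memC s u).1 hu i).2 h]
    · have : u ∉ A i := fun h' => h (((memC s u).1 hu i).1 h')
      simp [h, this]
  have hcm : ∀ s, Measurable fun x : Config E =>
      x.1 (C s) * Ψ (fun i => x.1 (A i)) := fun s =>
    (measurable_count (hC s)).mul
      (hΨ.comp (measurable_pi_lambda _ fun i => measurable_count (hA i)))
  have hR : ∀ x : Config E, ∫⁻ u in A b, Ψ (fun i => (addPoint x u).1 (A i)) ∂lam =
      ∑ s with b ∈ s, lam (C s) * Ψ (T fun t => x.1 (C t) + if t = s then 1 else 0) := by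
    intro x
    conv_lhs => rw [hAC b]
    rw [lintegral_biUnion_finset (hdi b) fun s _ => hC s]
    refine Finset.sum_congr rfl fun s _ => ?_
    rw [setLIntegral_congr_fun (hC s) (g := fun _ => Ψ (T fun t => x.1 (C t) + if t = s then 1 else 0))
      fun u hu => by simp only [hTadd x s u hu], setLIntegral_const, mul_comm]
  have hmT : ∀ s, Measurable fun x : Config E =>
      Ψ (T fun t => x.1 (C t) + if t = s then 1 else 0) := fun s =>
    (hΨ.comp hT).comp (measurable_pi_lambda _ fun t => (measurable_count (hC t)).add_const _)
  simp_rw [hR]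
  rw [lintegral_finsetSum _ fun s _ => (hmT s).const_mul _]
  simp_rw [hsum _ b, Finset.sum_mul]
  rw [lintegral_finsetSum _ fun s _ => hcm s]
  refine Finset.sum_congr rfl fun s _ => ?_
  simp_rw [hTx]
  rw [lintegral_const_mul _ (hmT s)]
  exact hQ.lintegral_count_mul_of_disjoint hC hd s (hΨ.comp hT)

/-- Two finite measures on configurations agree once they agree on events given by finitely many
counts, and there the identity is the preceding one with an indicator as integrand. -/
theorem IsPoissonLaw.withDensity_count [IsFiniteMeasure lam] (hQ : IsPoissonLaw lam Q) {A : Set E}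
    (hA : MeasurableSet A) :
    Q.withDensity (fun x => x.1 A) =
      (Q.prod (lam.restrict A)).map fun q : Config E × E => addPoint q.1 q.2 := by
  classical
  have := hQ.isProbabilityMeasure
  have key : ∀ (t : Finset {A : Set E // MeasurableSet A}) (S : Set (Config E)),
      (∃ D : {A : Set E // MeasurableSet A} → Set ℝ≥0∞, (∀ a ∈ t, MeasurableSet (D a)) ∧
        S = ⋂ a ∈ t, (fun x : Config E => x.1 a.1) ⁻¹' D a) →
      Q.withDensity (fun x => x.1 A) S =
        (Q.prod (lam.restrict A)).map (fun q : Config E × E => addPoint q.1 q.2) S := by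
    rintro t S ⟨D, hD, rfl⟩
    -- The index `none` carries the weighting set `A`, so that its count is one of the family.
    let A' : Option t → Set E := fun o => o.elim A fun a => a.1.1
    have hA' : ∀ o, MeasurableSet (A' o) := by
      rintro (_ | a)
      exacts [hA, a.1.2]
    let R : Set (Option t → ℝ≥0∞) := ⋂ a : t, (fun y => y (some a)) ⁻¹' D a.1
    have hR : MeasurableSet R := MeasurableSet.iInter fun a =>
      measurable_pi_apply (some a) (hD a.1 a.2)
    have hS : (⋂ a ∈ t, (fun x : Config E => x.1 a.1) ⁻¹' D a) =
        (fun x : Config E => fun o => x.1 (A' o)) ⁻¹' R := by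
      ext x
      simp [R, A']
    have hSm : MeasurableSet ((fun x : Config E => fun o => x.1 (A' o)) ⁻¹' R) :=
      (measurable_pi_lambda _ fun o => measurable_count (hA' o)) hR
    have h := hQ.lintegral_count_mul hA' none (measurable_one.indicator hR)
    rw [hS, withDensity_apply _ hSm, ← lintegral_indicator hSm,
      Measure.map_apply measurable_addPoint hSm,
      Measure.prod_apply (measurable_addPoint hSm)]
    refine Eq.trans (lintegral_congr fun x => ?_) (h.trans (lintegral_congr fun x => ?_))
    · by_cases hx : (fun o => x.1 (A' o)) ∈ R
      · have hx' : x ∈ (fun x : Config E => fun o => x.1 (A' o)) ⁻¹' R := hx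
        simp [hx, hx', A']
      · have hx' : x ∉ (fun x : Config E => fun o => x.1 (A' o)) ⁻¹' R := hx
        simp [hx, hx', A']
    · rw [← lintegral_indicator_one (measurable_prodMk_left (measurable_addPoint hSm))]
      rfl
  have : IsFiniteMeasure (Q.withDensity fun x => x.1 A) := by
    refine isFiniteMeasure_withDensity ?_
    -- The empty family of counts gives the total mass, hence finiteness.
    have h := key ∅ Set.univ ⟨fun _ => ∅, by simp, by simp⟩
    rw [withDensity_apply _ MeasurableSet.univ, setLIntegral_univ] at h
    rw [h]
    exact measure_ne_top _ _
  refine ext_of_generate_finite _ config_measurableSpace_eq_generateFrom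
    (isPiSystem_piiUnionInter _ (fun _ => @MeasurableSpace.isPiSystem_measurableSet _ (_)) _) ?_ ?_
  · rintro S ⟨t, -, g, hg, rfl⟩
    choose! D hD hgD using hg
    refine key t _ ⟨D, hD, Set.iInter₂_congr fun a ha => (hgD a ha).symm⟩
  · exact key ∅ Set.univ ⟨fun _ => ∅, by simp, by simp⟩

/-- The **Mecke formula** for a Poisson process. -/
theorem IsPoissonLaw.mecke [IsFiniteMeasure lam] (hQ : IsPoissonLaw lam Q)
    {h : Config E × E → ℝ≥0∞} (hh : Measurable h) :
    ∫⁻ x, ∫⁻ u, h (x, u) ∂x.1 ∂Q = ∫⁻ x, ∫⁻ u, h (addPoint x u, u) ∂lam ∂Q := by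
  have := hQ.isProbabilityMeasure
  have hφ : Measurable fun q : Config E × E => (addPoint q.1 q.2, q.2) :=
    measurable_addPoint.prodMk measurable_snd
  -- `Q ⊗ₘ configKernel E` is the Campbell measure; on the rectangle over `S` and `A` its value is
  -- that of the density `x ↦ x.1 A` on `S`.
  have hrect : ∀ {S : Set (Config E)} {A : Set E}, MeasurableSet S → MeasurableSet A →
      ((Q.prod lam).map fun q : Config E × E => (addPoint q.1 q.2, q.2)) (S ×ˢ A) =
        (Q ⊗ₘ configKernel E) (S ×ˢ A) := by
    intro S A hS hA
    rw [Measure.map_apply hφ (hS.prod hA), Measure.compProd_apply_prod hS hA]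
    have h := congrArg (fun m => m S) (hQ.withDensity_count hA)
    simp only [withDensity_apply _ hS] at h
    simp only [configKernel_apply]
    rw [h, Measure.map_apply measurable_addPoint hS, Measure.prod_apply (measurable_addPoint hS),
      Measure.prod_apply (hφ (hS.prod hA))]
    refine lintegral_congr fun x => ?_
    rw [Measure.restrict_apply (measurable_prodMk_left (measurable_addPoint hS))]
    rfl
  have heq : ((Q.prod lam).map fun q : Config E × E => (addPoint q.1 q.2, q.2)) =
      Q ⊗ₘ configKernel E := Measure.ext_prod hrect
  have h1 := Measure.lintegral_compProd (μ := Q) (κ := configKernel E) hh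
  rw [← heq, lintegral_map hh hφ] at h1
  exact h1.symm.trans (lintegral_prod _ (hh.comp hφ).aemeasurable)

end Poisson

/-! ### Tuples of different points -/

section Tuples

variable {E : Type*} [MeasurableSpace E] [MeasurableSingletonClass E]

theorem mem_points {x : Config E} {u : E} : u ∈ points x ↔ x.1 {u} ≠ 0 := by
  simp [points]

open Classical in
/-- The tuples of different points of `x` indexed by a finite type. -/
noncomputable def injTuples (ι : Type*) [Fintype ι] [DecidableEq ι] (x : Config E) :
    Finset (ι → E) :=
  (Fintype.piFinset fun _ : ι => points x).filter Function.Injective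

theorem mem_injTuples {ι : Type*} [Fintype ι] [DecidableEq ι] {x : Config E} {u : ι → E} :
    u ∈ injTuples ι x ↔ (∀ i, u i ∈ points x) ∧ Function.Injective u := by
  simp [injTuples]

theorem distinctTuples_eq_injTuples (k : ℕ) (x : Config E) :
    distinctTuples k x = injTuples (Fin k) x := by
  ext u
  simp [distinctTuples, mem_injTuples]

theorem injTuples_fin_zero (x : Config E) : injTuples (Fin 0) x = {isEmptyElim} := by
  ext u
  simp only [mem_injTuples, Finset.mem_singleton, IsEmpty.forall_iff, true_and]
  exact ⟨fun _ => Subsingleton.elim _ _, fun _ => Function.injective_of_subsingleton _⟩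

theorem ae_notMem_points (lam : Measure E) [NullSingletonClass lam] (x : Config E) :
    ∀ᵐ u ∂lam, u ∉ points x :=
  measure_mono_null (t := ↑(points x)) (fun u hu => by simpa using hu)
    ((points x).countable_toSet.measure_zero lam)

/-- Splitting off the first point sets up the inductions. Distinctness from the remaining points is
put into the summand, so that both sums run over sets depending on `x` alone. -/
theorem sum_injTuples_succ (k : ℕ) (x : Config E) (G : (Fin (k + 1) → E) → ℝ≥0∞) :
    ∑ u ∈ injTuples (Fin (k + 1)) x, G u = ∑ u₀ ∈ points x, ∑ u ∈ injTuples (Fin k) x,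
      ({q : E × (Fin k → E) | q.1 ∉ Set.range q.2}.indicator (fun q => G (Fin.cons q.1 q.2)))
        (u₀, u) := by
  classical
  rw [← Finset.sum_product']
  simp_rw [Set.indicator_apply]
  rw [← Finset.sum_filter]
  refine Finset.sum_bij' (fun u _ => (u 0, Fin.tail u)) (fun q _ => Fin.cons q.1 q.2) ?_ ?_ ?_ ?_ ?_
  · intro u hu
    rw [mem_injTuples] at hu
    simp only [Finset.mem_filter, Finset.mem_product, mem_injTuples, Set.mem_ofPred_eq]
    refine ⟨⟨hu.1 0, fun i => hu.1 _, fun i j hij => Fin.succ_injective _ (hu.2 hij)⟩, ?_⟩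
    rintro ⟨i, hi⟩
    exact Fin.succ_ne_zero i (hu.2 hi)
  · rintro ⟨u₀, u⟩ hu
    simp only [Finset.mem_filter, Finset.mem_product, mem_injTuples, Set.mem_ofPred_eq] at hu
    rw [mem_injTuples]
    exact ⟨fun i => Fin.cases hu.1.1 hu.1.2.1 i, Fin.cons_injective_iff.2 ⟨hu.2, hu.1.2.2⟩⟩
  · intro u _
    exact Fin.cons_self_tail u
  · intro q _
    simp
  · intro u _
    simp

theorem sum_injTuples_comp_equiv {ι κ : Type*} [Fintype ι] [DecidableEq ι] [Fintype κ]
    [DecidableEq κ] (e : ι ≃ κ) (x : Config E) (G : (ι → E) → ℝ≥0∞) :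
    ∑ u ∈ injTuples ι x, G u = ∑ u ∈ injTuples κ x, G (u ∘ e) := by
  refine Finset.sum_bij' (fun u _ => u ∘ e.symm) (fun u _ => u ∘ e) ?_ ?_ ?_ ?_ ?_
  · intro u hu
    rw [mem_injTuples] at hu ⊢
    exact ⟨fun i => hu.1 _, hu.2.comp e.symm.injective⟩
  · intro u hu
    rw [mem_injTuples] at hu ⊢
    exact ⟨fun i => hu.1 _, hu.2.comp e.injective⟩
  · intro u _; funext i; simp
  · intro u _; funext i; simp
  · intro u _
    congr 1
    funext i; simp

theorem card_injTuples_le (ι : Type*) [Fintype ι] [DecidableEq ι] (x : Config E) :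
    ((injTuples ι x).card : ℝ≥0∞) ≤ x.1 Set.univ ^ Fintype.card ι := by
  have h1 : (injTuples ι x).card ≤ (points x).card ^ Fintype.card ι := by
    classical
    refine (Finset.card_filter_le _ _).trans ?_
    simp [Fintype.card_piFinset]
  have h2 : ((points x).card : ℝ≥0∞) ≤ x.1 Set.univ := by
    calc ((points x).card : ℝ≥0∞) = ∑ u ∈ points x, 1 := by simp
      _ ≤ ∑ u ∈ points x, x.1 {u} := Finset.sum_le_sum fun u hu => by
          obtain ⟨n, hn⟩ := x.2 {u} (measurableSet_singleton u)
          have := mem_points.1 hu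
          rw [hn] at this ⊢
          exact_mod_cast Nat.one_le_iff_ne_zero.2 (by exact_mod_cast this)
      _ = x.1 ↑(points x) := sum_measure_singleton
      _ ≤ x.1 Set.univ := measure_mono (Set.subset_univ _)
  calc ((injTuples ι x).card : ℝ≥0∞) ≤ ((points x).card : ℝ≥0∞) ^ Fintype.card ι := by
        exact_mod_cast h1
    _ ≤ _ := pow_le_pow_left' h2 _

theorem points_addPoint [DecidableEq E] (x : Config E) (u : E) :
    points (addPoint x u) = insert u (points x) := by
  ext v
  rw [Finset.mem_insert, mem_points, mem_points, addPoint_apply _ _ (measurableSet_singleton v)]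
  by_cases h : u = v
  · simp [h]
  · simp [h, Ne.symm h]

/-- The indicator discards exactly the tuples that use the added point. -/
theorem sum_injTuples_addPoint {k : ℕ} {x : Config E} {u₀ : E} (h : u₀ ∉ points x)
    (G : E × (Fin k → E) → ℝ≥0∞) :
    ∑ u ∈ injTuples (Fin k) (addPoint x u₀),
      ({q : E × (Fin k → E) | q.1 ∉ Set.range q.2}.indicator G) (u₀, u) =
    ∑ u ∈ injTuples (Fin k) x, G (u₀, u) := by
  classical
  simp_rw [Set.indicator_apply]
  rw [← Finset.sum_filter]
  refine Finset.sum_congr ?_ fun _ _ => rfl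
  ext u
  simp only [Finset.mem_filter, mem_injTuples, points_addPoint, Finset.mem_insert,
    Set.mem_ofPred_eq, Set.mem_range, not_exists]
  constructor
  · rintro ⟨⟨h1, h2⟩, h3⟩
    exact ⟨fun i => (h1 i).resolve_left (h3 i), h2⟩
  · rintro ⟨h1, h2⟩
    exact ⟨⟨fun i => Or.inr (h1 i), h2⟩, fun i hi => h (hi ▸ h1 i)⟩

/-- The inverse of the multiplicity of a point, `0` if the multiplicity vanishes. -/
noncomputable def invMult (t : ℝ≥0∞) : ℝ≥0∞ := ({0}ᶜ : Set ℝ≥0∞).indicator (fun t => t⁻¹) t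

theorem measurable_invMult : Measurable invMult :=
  measurable_inv.indicator (measurableSet_singleton _).compl

/-- A sum over the support becomes an integral against `x`, to which measurability results and Mecke
apply; simplicity of the Poisson process is never needed. The convention at multiplicity `0` makes
the integrand vanish off the atoms. -/
theorem lintegral_mul_invMult (x : Config E) (h : E → ℝ≥0∞) :
    ∫⁻ u, h u * invMult (x.1 {u}) ∂x.1 = ∑ u ∈ points x, h u := by
  have h1 : (fun u => h u * invMult (x.1 {u})) =
      (↑(points x) : Set E).indicator fun u => h u * (x.1 {u})⁻¹ := by
    funext u
    by_cases hu : x.1 {u} = 0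
    · simp [invMult, hu, mem_points]
    · simp [invMult, hu, mem_points]
  rw [h1, lintegral_indicator (Finset.measurableSet _), lintegral_finset]
  refine Finset.sum_congr rfl fun u hu => ?_
  rw [mul_assoc, ENNReal.inv_mul_cancel (mem_points.1 hu) (count_ne_top _ _), mul_one]

end Tuples

/-! ### Measurability of sums over tuples -/

section Measurability

universe v

variable {E : Type v} [MeasurableSpace E]

theorem measurable_finCons (k : ℕ) :
    Measurable fun q : E × (Fin k → E) => (Fin.cons q.1 q.2 : Fin (k + 1) → E) := by
  refine measurable_pi_lambda _ fun i => ?_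
  refine Fin.cases ?_ (fun j => ?_) i
  · exact measurable_fst
  · exact (measurable_pi_apply j).comp measurable_snd

variable [MeasurableEq E]

theorem measurable_count_singleton : Measurable fun q : E × Config E => q.2.1 {q.1} := by
  have ht : MeasurableSet {r : (E × Config E) × E | r.2 = r.1.1} :=
    measurableSet_eq_fun measurable_snd (measurable_fst.comp measurable_fst)
  exact Kernel.measurable_kernel_prodMk_left
    (κ := (configKernel E).comap (Prod.snd : E × Config E → Config E) measurable_snd) ht

theorem measurableSet_notMem_range (k : ℕ) :
    MeasurableSet {q : E × (Fin k → E) | q.1 ∉ Set.range q.2} := by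
  have : {q : E × (Fin k → E) | q.1 ∉ Set.range q.2} = ⋂ i, {q | q.2 i = q.1}ᶜ := by
    ext q
    simp
  rw [this]
  exact MeasurableSet.iInter fun i => (measurableSet_eq_fun
    (f := fun q : E × (Fin k → E) => q.2 i) (by fun_prop) measurable_fst).compl

variable [MeasurableSingletonClass E]

theorem measurable_sum_points {T : Type*} [MeasurableSpace T] {h : E → T × Config E → ℝ≥0∞}
    (hh : Measurable fun q : E × (T × Config E) => h q.1 q.2) :
    Measurable fun q : T × Config E => ∑ u ∈ points q.2, h u q := by
  simp_rw [← lintegral_mul_invMult]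
  refine measurable_lintegral_config (h := fun u q => h u q * invMult (q.2.1 {u})) (hh.mul ?_)
  exact measurable_invMult.comp (measurable_count_singleton.comp
    (measurable_fst.prodMk (measurable_snd.comp measurable_snd)))

/-- In the induction the first point joins the parameter, which passes from `T` to `E × T`; placing
`T` in the universe of `E` keeps this type within reach of the induction hypothesis. -/
theorem measurable_sum_injTuples {k : ℕ} {T : Type v} [MeasurableSpace T]
    {G : (Fin k → E) → T × Config E → ℝ≥0∞}
    (hG : Measurable fun q : (Fin k → E) × (T × Config E) => G q.1 q.2) :
    Measurable fun q : T × Config E => ∑ u ∈ injTuples (Fin k) q.2, G u q := by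
  induction k generalizing T with
  | zero =>
    simp_rw [injTuples_fin_zero, Finset.sum_singleton]
    exact hG.comp measurable_prodMk_left
  | succ k ih =>
    simp_rw [sum_injTuples_succ]
    refine measurable_sum_points (h := fun u₀ q => ∑ u ∈ injTuples (Fin k) q.2,
      ({r : E × (Fin k → E) | r.1 ∉ Set.range r.2}.indicator
        (fun r => G (Fin.cons r.1 r.2) q)) (u₀, u)) ?_
    have h := ih (T := E × T) (G := fun u q =>
      ({r : E × (Fin k → E) | r.1 ∉ Set.range r.2}.indicator
        (fun r => G (Fin.cons r.1 r.2) (q.1.2, q.2))) (q.1.1, u)) ?_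
    · have hassoc : Measurable fun q : E × (T × Config E) => ((q.1, q.2.1), q.2.2) := by fun_prop
      have h2 := h.comp hassoc
      simp only [Function.comp_def] at h2
      exact h2
    · have hr : Measurable fun q : (Fin k → E) × ((E × T) × Config E) => (q.2.1.1, q.1) := by
        fun_prop
      have hcons : Measurable fun q : (Fin k → E) × ((E × T) × Config E) =>
          (Fin.cons q.2.1.1 q.1 : Fin (k + 1) → E) := (measurable_finCons k).comp hr
      have hs : Measurable fun q : (Fin k → E) × ((E × T) × Config E) => (q.2.1.2, q.2.2) := by
        fun_prop
      have h1 : Measurable fun q : (Fin k → E) × ((E × T) × Config E) =>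
          G (Fin.cons q.2.1.1 q.1) (q.2.1.2, q.2.2) := hG.comp (hcons.prodMk hs)
      exact h1.indicator (hr (measurableSet_notMem_range k))

theorem measurable_sum_injTuples_fintype {ι : Type*} [Fintype ι] [DecidableEq ι]
    {G : (ι → E) × Config E → ℝ≥0∞} (hG : Measurable G) :
    Measurable fun x : Config E => ∑ u ∈ injTuples ι x, G (u, x) := by
  have h : Measurable fun q : (Fin (Fintype.card ι) → E) × (PUnit.{v + 1} × Config E) =>
      (q.1 ∘ Fintype.equivFin ι, q.2.2) := by
    refine Measurable.prodMk ?_ (measurable_snd.comp measurable_snd)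
    exact measurable_pi_lambda _ fun i => (measurable_pi_apply _).comp measurable_fst
  have h' := (measurable_sum_injTuples (G := fun u (q : PUnit.{v + 1} × Config E) =>
    G (u ∘ Fintype.equivFin ι, q.2)) (hG.comp h)).comp
      (measurable_prodMk_left (x := (PUnit.unit : PUnit.{v + 1})))
  simp only [Function.comp_def] at h'
  simp_rw [fun x => sum_injTuples_comp_equiv (Fintype.equivFin ι) x fun u => G (u, x)]
  exact h'

end Measurability

/-! ### The multivariate Mecke formula -/

section Mecke

theorem measurable_lintegral_addPoints {E : Type*} [MeasurableSpace E] {Q : Measure (Config E)}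
    [SFinite Q] {ι : Type*} [Fintype ι] {G : (ι → E) × Config E → ℝ≥0∞} (hG : Measurable G) :
    Measurable fun u : ι → E => ∫⁻ x, G (u, addPoints x u) ∂Q := by
  refine Measurable.lintegral_prod_right'
    (f := fun q : (ι → E) × Config E => G (q.1, addPoints q.2 q.1)) ?_
  exact hG.comp (measurable_fst.prodMk (measurable_addPoints.comp measurable_swap))

universe v

variable {E : Type v} [MeasurableSpace E] [MeasurableEq E] [MeasurableSingletonClass E]
  {lam : Measure E} {Q : Measure (Config E)}

/-- As `lam` has no atoms, the added point almost surely avoids the finitely many points of `x`, so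
its multiplicity is `1` and the correcting weight disappears. -/
theorem IsPoissonLaw.mecke_points [IsFiniteMeasure lam] [NullSingletonClass lam]
    (hQ : IsPoissonLaw lam Q) {h : Config E × E → ℝ≥0∞} (hh : Measurable h) :
    ∫⁻ x, ∑ u ∈ points x, h (x, u) ∂Q = ∫⁻ x, ∫⁻ u, h (addPoint x u, u) ∂lam ∂Q := by
  simp_rw [← lintegral_mul_invMult]
  rw [hQ.mecke (h := fun q => h q * invMult (q.1.1 {q.2})) (hh.mul
    (measurable_invMult.comp (measurable_count_singleton.comp measurable_swap)))]
  refine lintegral_congr fun x => lintegral_congr_ae ?_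
  filter_upwards [ae_notMem_points lam x] with u hu
  rw [mem_points, not_not] at hu
  simp [addPoint_apply _ _ (measurableSet_singleton u), hu, invMult]

theorem measurable_sum_indicator_notMem_range {k : ℕ}
    {G : (Fin (k + 1) → E) × Config E → ℝ≥0∞} (hG : Measurable G) :
    Measurable fun q : E × Config E => ∑ u ∈ injTuples (Fin k) q.2,
      ({r : E × (Fin k → E) | r.1 ∉ Set.range r.2}.indicator
        (fun r => G (Fin.cons r.1 r.2, q.2))) (q.1, u) := by
  refine measurable_sum_injTuples (G := fun u q =>
    ({r : E × (Fin k → E) | r.1 ∉ Set.range r.2}.indicator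
      (fun r => G (Fin.cons r.1 r.2, q.2))) (q.1, u)) ?_
  have hr : Measurable fun q : (Fin k → E) × (E × Config E) => (q.2.1, q.1) := by fun_prop
  have hs : Measurable fun q : (Fin k → E) × (E × Config E) => q.2.2 := by fun_prop
  have hcons : Measurable fun q : (Fin k → E) × (E × Config E) =>
      (Fin.cons q.2.1 q.1 : Fin (k + 1) → E) := (measurable_finCons k).comp hr
  have h1 : Measurable fun q : (Fin k → E) × (E × Config E) =>
      G (Fin.cons q.2.1 q.1, q.2.2) := hG.comp (hcons.prodMk hs)
  exact h1.indicator (hr (measurableSet_notMem_range k))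

/-- The multivariate **Mecke formula** for a Poisson process with atomless intensity. -/
theorem IsPoissonLaw.mecke_fin [IsFiniteMeasure lam] [NullSingletonClass lam]
    (hQ : IsPoissonLaw lam Q) {k : ℕ} {G : (Fin k → E) × Config E → ℝ≥0∞} (hG : Measurable G) :
    ∫⁻ x, ∑ u ∈ injTuples (Fin k) x, G (u, x) ∂Q =
      ∫⁻ u, ∫⁻ x, G (u, addPoints x u) ∂Q ∂Measure.pi fun _ => lam := by
  have := hQ.isProbabilityMeasure
  induction k with
  | zero =>
    have h1 : ∀ (x : Config E) (u : Fin 0 → E), addPoints x u = x := fun x u =>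
      Subtype.ext (by simp [coe_addPoints])
    have hm : Measurable fun u : Fin 0 → E => ∫⁻ x, G (u, x) ∂Q := hG.lintegral_prod_right'
    simp_rw [injTuples_fin_zero, h1, Finset.sum_singleton]
    rw [Measure.pi_of_empty _ isEmptyElim, lintegral_dirac' _ hm]
  | succ k ih =>
    simp_rw [sum_injTuples_succ]
    have hcons : Measurable fun q : (Fin k → E) × (E × Config E) =>
        (Fin.cons q.2.1 q.1 : Fin (k + 1) → E) :=
      (measurable_finCons k).comp (by fun_prop : Measurable fun q : (Fin k → E) × (E × Config E) =>
        (q.2.1, q.1))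
    have hH := measurable_sum_indicator_notMem_range hG
    have hH' := hH.comp (measurable_swap (α := Config E) (β := E))
    simp only [Function.comp_def, Prod.fst_swap, Prod.snd_swap] at hH'
    -- The one-point formula integrates out the first point; the induction hypothesis then treats
    -- the others with `u₀` fixed.
    rw [hQ.mecke_points (h := fun q => ∑ u ∈ injTuples (Fin k) q.1,
        ({r : E × (Fin k → E) | r.1 ∉ Set.range r.2}.indicator
          (fun r => G (Fin.cons r.1 r.2, q.1))) (q.2, u)) hH']
    have hadd : Measurable fun q : E × Config E => addPoint q.2 q.1 :=
      measurable_addPoint.comp measurable_swap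
    have hG' : Measurable fun q : (Fin k → E) × (E × Config E) =>
        G (Fin.cons q.2.1 q.1, addPoint q.2.2 q.2.1) :=
      hG.comp (hcons.prodMk (hadd.comp measurable_snd))
    calc ∫⁻ x, ∫⁻ u₀, ∑ u ∈ injTuples (Fin k) (addPoint x u₀),
        ({r : E × (Fin k → E) | r.1 ∉ Set.range r.2}.indicator
          (fun r => G (Fin.cons r.1 r.2, addPoint x u₀))) (u₀, u) ∂lam ∂Q
      _ = ∫⁻ x, ∫⁻ u₀, ∑ u ∈ injTuples (Fin k) x,
            G (Fin.cons u₀ u, addPoint x u₀) ∂lam ∂Q := by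
          refine lintegral_congr fun x => lintegral_congr_ae ?_
          filter_upwards [ae_notMem_points lam x] with u₀ hu₀
          exact sum_injTuples_addPoint hu₀ fun r => G (Fin.cons r.1 r.2, addPoint x u₀)
      _ = ∫⁻ u₀, ∫⁻ x, ∑ u ∈ injTuples (Fin k) x,
            G (Fin.cons u₀ u, addPoint x u₀) ∂Q ∂lam := by
          have hswap := (measurable_sum_injTuples (G := fun u (q : E × Config E) =>
            G (Fin.cons q.1 u, addPoint q.2 q.1)) hG').comp
              (measurable_swap (α := Config E) (β := E))
          simp only [Function.comp_def, Prod.fst_swap, Prod.snd_swap] at hswap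
          exact lintegral_lintegral_swap hswap.aemeasurable
      _ = ∫⁻ u₀, ∫⁻ u : Fin k → E, ∫⁻ x, G (Fin.cons u₀ u, addPoints x (Fin.cons u₀ u)) ∂Q
            ∂(Measure.pi fun _ => lam) ∂lam := by
          refine lintegral_congr fun u₀ => ?_
          have hins : Measurable fun q : (Fin k → E) × Config E => (q.1, (u₀, q.2)) := by fun_prop
          have hG'' := hG'.comp hins
          simp only [Function.comp_def] at hG''
          rw [ih hG'']
          simp_rw [addPoint_addPoints]
      _ = _ := by
          have hmain := measurable_lintegral_addPoints (Q := Q) hG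
          have hpres := (measurePreserving_piFinSuccAbove (fun _ : Fin (k + 1) => lam) 0).symm
          have hprod := lintegral_prod (μ := lam) (ν := Measure.pi fun _ : Fin k => lam) _
            (hmain.comp hpres.measurable).aemeasurable
          have hpi := hpres.lintegral_comp hmain
          refine Eq.trans ?_ hpi
          refine Eq.trans ?_ hprod.symm
          have hsymm : ∀ q : E × (Fin k → E),
              (MeasurableEquiv.piFinSuccAbove (fun _ : Fin (k + 1) => E) 0).symm q =
                Fin.cons q.1 q.2 := fun q => by
            funext i
            refine Fin.cases ?_ (fun j => ?_) i <;> simp [MeasurableEquiv.piFinSuccAbove]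
          simp only [Function.comp_apply, hsymm]

/-- The multivariate **Mecke formula**, for tuples indexed by a finite type. -/
theorem IsPoissonLaw.mecke_fintype [IsFiniteMeasure lam] [NullSingletonClass lam]
    (hQ : IsPoissonLaw lam Q) {ι : Type*} [Fintype ι] [DecidableEq ι]
    {G : (ι → E) × Config E → ℝ≥0∞} (hG : Measurable G) :
    ∫⁻ x, ∑ u ∈ injTuples ι x, G (u, x) ∂Q =
      ∫⁻ u, ∫⁻ x, G (u, addPoints x u) ∂Q ∂Measure.pi fun _ => lam := by
  have := hQ.isProbabilityMeasure
  let e := Fintype.equivFin ι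
  have hφ : Measurable fun u : Fin (Fintype.card ι) → E => u ∘ e :=
    measurable_pi_lambda _ fun i => measurable_pi_apply (e i)
  have h := hQ.mecke_fin (G := fun q => G (q.1 ∘ e, q.2))
    (hG.comp ((hφ.comp measurable_fst).prodMk measurable_snd))
  have hsum : ∀ x : Config E, ∑ u ∈ injTuples ι x, G (u, x) =
      ∑ u ∈ injTuples (Fin (Fintype.card ι)) x, G (u ∘ e, x) := fun x =>
    sum_injTuples_comp_equiv e x fun u => G (u, x)
  have hadd : ∀ (x : Config E) (u : Fin (Fintype.card ι) → E),
      addPoints x (u ∘ e) = addPoints x u := fun x u => Subtype.ext (by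
    simp only [coe_addPoints, Function.comp_apply]
    rw [Equiv.sum_comp e fun j => Measure.dirac (u j)])
  simp_rw [hsum]
  rw [h]
  simp_rw [← hadd]
  have hmain := measurable_lintegral_addPoints (Q := Q) hG
  have hpres := measurePreserving_piCongrLeft (fun _ : ι => lam) e.symm
  rw [← hpres.lintegral_comp hmain]
  refine lintegral_congr fun u => ?_
  have : (MeasurableEquiv.piCongrLeft (fun _ : ι => E) e.symm) u = u ∘ e := by
    funext i
    obtain ⟨j, rfl⟩ := e.symm.surjective i
    have := MeasurableEquiv.piCongrLeft_apply_apply (β := fun _ : ι => E) e.symm u j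
    simpa using this
  rw [this]

end Mecke

/-! ### Diagram partitions -/

section Diagrams

variable {E : Type*} {m : ℕ} {k : Fin m → ℕ}

theorem blockOf_eq_iff (σ : Finpartition (Finset.univ : Finset (Vars k))) {a b : Vars k} :
    blockOf σ a = blockOf σ b ↔ b ∈ σ.part a := by
  rw [blockOf, blockOf, Subtype.mk.injEq, eq_comm]
  exact (σ.mem_part_iff_part_eq_part (Finset.mem_univ _) (Finset.mem_univ _)).symm

theorem blockOf_surjective (σ : Finpartition (Finset.univ : Finset (Vars k))) :
    Function.Surjective (blockOf σ) := by
  rintro ⟨b, hb⟩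
  obtain ⟨a, ha⟩ := σ.nonempty_of_mem_parts hb
  exact ⟨a, Subtype.ext (σ.part_eq_of_mem hb ha)⟩

/-- This is the form in which the condition meets tuples: variables of one function must receive
different points. -/
theorem mem_diagramPartitions {σ : Finpartition (Finset.univ : Finset (Vars k))} :
    σ ∈ diagramPartitions k ↔
      ∀ i, Function.Injective fun j : Fin (k i) => blockOf σ ⟨i, j⟩ := by
  simp only [diagramPartitions, Finset.mem_filter, Finset.mem_univ, true_and, Finset.card_le_one,
    Finset.mem_filter]
  constructor
  · intro h i j j' hjj'
    have := h i (σ.part ⟨i, j⟩) (σ.part_mem.2 (Finset.mem_univ _)) ⟨i, j⟩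
      ⟨σ.mem_part (Finset.mem_univ _), rfl⟩ ⟨i, j'⟩ ⟨(blockOf_eq_iff σ).1 hjj', rfl⟩
    simpa using this
  · rintro h i b hb ⟨a, j⟩ ⟨haj, rfl⟩ ⟨a', j'⟩ ⟨haj', h'⟩
    obtain rfl : a' = a := h'
    have : j = j' := h a' (Subtype.ext
      ((σ.part_eq_of_mem hb haj).trans (σ.part_eq_of_mem hb haj').symm))
    rw [this]

theorem finpartition_eq_of_blockOf {σ τ : Finpartition (Finset.univ : Finset (Vars k))}
    (h : ∀ a b, blockOf σ a = blockOf σ b ↔ blockOf τ a = blockOf τ b) : σ = τ := by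
  have hp : ∀ a, σ.part a = τ.part a := fun a => by
    ext b
    rw [← blockOf_eq_iff, ← blockOf_eq_iff, h]
  have key : ∀ {σ τ : Finpartition (Finset.univ : Finset (Vars k))},
      (∀ a, σ.part a = τ.part a) → σ.parts ⊆ τ.parts := by
    intro σ τ hp b hb
    obtain ⟨a, ha⟩ := σ.nonempty_of_mem_parts hb
    rw [← σ.part_eq_of_mem hb ha, hp]
    exact τ.part_mem.2 (Finset.mem_univ a)
  exact Finpartition.ext (Finset.Subset.antisymm (key hp) (key fun a => (hp a).symm))

variable [MeasurableSpace E] [MeasurableSingletonClass E]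

/-- A product of sums over tuples of different points is a sum over the diagram partitions. -/
theorem prod_sum_distinctTuples (f : (i : Fin m) → (Fin (k i) → E) → ℝ) (x : Config E) :
    ∏ i, ∑ u ∈ distinctTuples (k i) x, f i u =
      ∑ σ ∈ diagramPartitions k, ∑ v ∈ injTuples {b // b ∈ σ.parts} x,
        contractedTensor f σ v := by
  classical
  rw [Finset.prod_univ_sum, Finset.sum_sigma']
  symm
  refine Finset.sum_bij (fun q _ => fun i j => q.2 (blockOf q.1 ⟨i, j⟩)) ?_ ?_ ?_ ?_
  · rintro ⟨σ, v⟩ hq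
    simp only [Finset.mem_sigma, mem_injTuples, mem_diagramPartitions] at hq
    simp only [Fintype.mem_piFinset, distinctTuples_eq_injTuples, mem_injTuples]
    exact fun i => ⟨fun j => hq.2.1 _, hq.2.2.comp (hq.1 i)⟩
  · rintro ⟨σ, v⟩ hq ⟨τ, w⟩ hq' heq
    simp only [Finset.mem_sigma, mem_injTuples] at hq hq'
    have heq' : ∀ a : Vars k, v (blockOf σ a) = w (blockOf τ a) := fun a =>
      congrFun (congrFun heq a.1) a.2
    -- Different blocks carry different points, so the partition can be read off from the
    -- coincidences.
    obtain rfl : σ = τ := finpartition_eq_of_blockOf fun a b => by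
      rw [← hq.2.2.eq_iff, ← hq'.2.2.eq_iff, heq', heq']
    have : v = w := funext fun b => by
      obtain ⟨a, rfl⟩ := blockOf_surjective σ b
      exact heq' a
    rw [this]
  · intro w hw
    simp only [Fintype.mem_piFinset, distinctTuples_eq_injTuples, mem_injTuples] at hw
    let w' : Vars k → E := fun a => w a.1 a.2
    -- Variables share a block exactly when they receive the same point.
    let σ : Finpartition (Finset.univ : Finset (Vars k)) := Finpartition.ofSetoid (Setoid.ker w')
    have hσ : ∀ a b, blockOf σ a = blockOf σ b ↔ w' a = w' b := fun a b => by
      rw [blockOf_eq_iff]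
      exact Finpartition.mem_part_ofSetoid_iff_rel
    let v : {b // b ∈ σ.parts} → E := fun b => w' (Function.surjInv (blockOf_surjective σ) b)
    have hv : ∀ a, v (blockOf σ a) = w' a := fun a =>
      (hσ _ _).1 (Function.surjInv_eq (blockOf_surjective σ) _)
    refine ⟨⟨σ, v⟩, ?_, ?_⟩
    · simp only [Finset.mem_sigma, mem_injTuples, mem_diagramPartitions]
      refine ⟨fun i j j' hjj' => (hw i).2 ((hσ ⟨i, j⟩ ⟨i, j'⟩).1 hjj'), fun b => (hw _).1 _, ?_⟩
      intro b b' hbb'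
      obtain ⟨a, rfl⟩ := blockOf_surjective σ b
      obtain ⟨a', rfl⟩ := blockOf_surjective σ b'
      rw [hv, hv] at hbb'
      exact (hσ _ _).2 hbb'
    · funext i j
      exact hv ⟨i, j⟩
  · rintro ⟨σ, v⟩ _
    rfl

end Diagrams

/-! ### Moment bounds -/

section Moments

/-- The Poisson shift lowers the power by one at the price of replacing `n` by `n + 1`, which costs
only a constant factor and an additive constant. -/
theorem lintegral_pow_poissonMeasure_ne_top (r : ℝ≥0) (j : ℕ) :
    ∫⁻ n : ℕ, (n : ℝ≥0∞) ^ j ∂poissonMeasure r ≠ ∞ := by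
  induction j with
  | zero => simp
  | succ j ih =>
    have hle : ∀ n : ℕ, ((n + 1 : ℕ) : ℝ≥0∞) ^ j ≤ 2 ^ j * ((n : ℝ≥0∞) ^ j + 1) := by
      intro n
      have : (n + 1) ^ j ≤ 2 ^ j * (n ^ j + 1) := by
        rcases Nat.eq_zero_or_pos n with rfl | hn
        · simpa using Nat.mul_le_mul (Nat.one_le_two_pow (n := j)) (Nat.le_add_left 1 (0 ^ j))
        · calc (n + 1) ^ j ≤ (2 * n) ^ j := Nat.pow_le_pow_left (by omega) j
            _ = 2 ^ j * n ^ j := mul_pow _ _ _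
            _ ≤ _ := Nat.mul_le_mul_left _ (Nat.le_succ _)
      exact_mod_cast this
    simp_rw [pow_succ']
    rw [lintegral_nat_mul_poissonMeasure r fun n => (n : ℝ≥0∞) ^ j]
    refine ENNReal.mul_ne_top ENNReal.coe_ne_top
      (ne_top_of_le_ne_top ?_ (lintegral_mono fun n => hle n))
    rw [lintegral_const_mul _ (measurable_of_countable _),
      lintegral_add_right _ measurable_const]
    refine ENNReal.mul_ne_top (by simp) (ENNReal.add_ne_top.2 ⟨ih, by simp⟩)

theorem mul_le_sq_add_sq (a b : ℝ≥0∞) : a * b ≤ a ^ 2 + b ^ 2 := by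
  rcases le_total a b with h | h
  · exact (mul_le_mul_left h b).trans ((sq b).symm.le.trans le_add_self)
  · exact (mul_le_mul_right h a).trans ((sq a).symm.le.trans le_self_add)

variable {E : Type*} [MeasurableSpace E] {lam : Measure E} {Q : Measure (Config E)}

theorem IsPoissonLaw.lintegral_pow_count_mul_ne_top (hQ : IsPoissonLaw lam Q)
    {p : Config E → ℝ≥0} (hp : Measurable p) (hp2 : MemLp (fun x => (p x : ℝ)) 2 Q) (n : ℕ) :
    ∫⁻ x, x.1 Set.univ ^ n * p x ∂Q ≠ ∞ := by
  refine ne_top_of_le_ne_top ?_ (lintegral_mono fun x =>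
    mul_le_sq_add_sq (x.1 Set.univ ^ n) (p x))
  rw [lintegral_add_right _ (hp.coe_nnreal_ennreal.pow_const 2)]
  refine ENNReal.add_ne_top.2 ⟨?_, ?_⟩
  · simp_rw [← pow_mul]
    rw [hQ.lintegral_count MeasurableSet.univ (g := fun t => t ^ (n * 2))
      (measurable_id.pow_const _)]
    exact lintegral_pow_poissonMeasure_ne_top _ _
  · have h := hp2.integrable_sq
    rw [← lintegral_ofReal_ne_top_iff_integrable h.aestronglyMeasurable
      (Filter.Eventually.of_forall fun x => by positivity)] at h
    convert h using 3 with x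
    rw [ENNReal.ofReal_pow (by positivity), ENNReal.ofReal_coe_nnreal]

end Moments

/-! ### Conditional intensities -/

section CondIntensity

variable {E : Type*} [MeasurableSpace E] {p : Config E → ℝ≥0} {ι : Type*} [Fintype ι]

theorem condIntensity_nonneg (u : ι → E) (x : Config E) : 0 ≤ condIntensity p u x := by
  rw [condIntensity]
  split_ifs <;> positivity

theorem measurable_condIntensity (hp : Measurable p) (u : ι → E) :
    Measurable (condIntensity p u) := by
  unfold condIntensity
  split_ifs
  · exact measurable_const
  · exact (hp.comp (measurable_addPoints.comp measurable_prodMk_right)).coe_nnreal_real.div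
      hp.coe_nnreal_real

/-- Heredity is what makes this hold at every `x`: where `p x = 0`, adding points cannot make the
density positive. -/
theorem Hereditary.mul_condIntensity (hher : Hereditary p) (u : ι → E) (x : Config E) :
    (p x : ℝ≥0∞) * ENNReal.ofReal (condIntensity p u x) = p (addPoints x u) := by
  rw [condIntensity]
  split_ifs with h
  · have : addPoints x u = x := Subtype.ext (by simp [coe_addPoints])
    simp [this]
  · rcases eq_or_ne (p x) 0 with hx | hx
    · have : p (addPoints x u) = 0 := by
        by_contra h0
        exact (hher (addPoints x u) x (Measure.le_add_right le_rfl) (pos_iff_ne_zero.2 h0)).ne' hx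
      simp [hx, this]
    · rw [← NNReal.coe_div, ENNReal.ofReal_coe_nnreal, ← ENNReal.coe_mul, mul_div_cancel₀ _ hx]

theorem lintegral_condIntensity_of_hasLaw {Ω : Type*} [MeasurableSpace Ω] {P : Measure Ω}
    {Q : Measure (Config E)}
    {μ : Ω → Config E} (hμ : HasLaw μ (Q.withDensity fun x => (p x : ℝ≥0∞)) P)
    (hp : Measurable p) (hher : Hereditary p) (u : ι → E) :
    ∫⁻ ω, ENNReal.ofReal (condIntensity p u (μ ω)) ∂P = ∫⁻ x, p (addPoints x u) ∂Q := by
  have hm := (measurable_condIntensity hp u).ennreal_ofReal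
  rw [hμ.lintegral_comp (f := fun x => ENNReal.ofReal (condIntensity p u x)) hm.aemeasurable,
    lintegral_withDensity_eq_lintegral_mul _ hp.coe_nnreal_ennreal hm]
  exact lintegral_congr fun x => hher.mul_condIntensity u x

/-- No integrability is required: if the mean is infinite, both sides take the default value `0`. -/
theorem integral_condIntensity_of_hasLaw {Ω : Type*} [MeasurableSpace Ω] {P : Measure Ω}
    {Q : Measure (Config E)}
    {μ : Ω → Config E} (hμ : HasLaw μ (Q.withDensity fun x => (p x : ℝ≥0∞)) P)
    (hp : Measurable p) (hher : Hereditary p) (u : ι → E) :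
    ∫ ω, condIntensity p u (μ ω) ∂P = (∫⁻ x, p (addPoints x u) ∂Q).toReal := by
  rw [integral_eq_lintegral_of_nonneg_ae
    (Filter.Eventually.of_forall fun ω => condIntensity_nonneg u (μ ω))
    ((measurable_condIntensity hp u).comp_aemeasurable hμ.aemeasurable).aestronglyMeasurable,
    lintegral_condIntensity_of_hasLaw hμ hp hher u]

end CondIntensity

/-! ### Contracted tensors -/

section ContractedTensor

variable {E : Type*}

theorem contractedTensor_nonneg {m : ℕ} {k : Fin m → ℕ} {f : (i : Fin m) → (Fin (k i) → E) → ℝ}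
    (hf : ∀ i u, 0 ≤ f i u) (σ : Finpartition (Finset.univ : Finset (Vars k)))
    (v : {b // b ∈ σ.parts} → E) : 0 ≤ contractedTensor f σ v :=
  Finset.prod_nonneg fun i _ => hf i _

theorem measurable_contractedTensor [MeasurableSpace E] {m : ℕ} {k : Fin m → ℕ} {f : (i : Fin m) → (Fin (k i) → E) → ℝ}
    (hf : ∀ i, Measurable (f i)) (σ : Finpartition (Finset.univ : Finset (Vars k))) :
    Measurable (contractedTensor f σ) := by
  refine Finset.measurable_fun_prod _ fun i _ => (hf i).comp ?_
  exact measurable_pi_lambda _ fun j => measurable_pi_apply _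

end ContractedTensor

/-! ### Moments of products in `ℝ≥0∞` -/

section ProductMoments

universe v

variable {E : Type v} [MeasurableSpace E] [MeasurableEq E] [MeasurableSingletonClass E]
  {lam : Measure E} [IsFiniteMeasure lam] [NullSingletonClass lam] {Q : Measure (Config E)}
  {p : Config E → ℝ≥0}

/-- By Mecke, the integral over `u` is the mean of `p` times the number of tuples of different
points, which a power of the total count bounds. The `f i` play no role, so finiteness also holds
where the contracted tensor vanishes. -/
theorem IsPoissonLaw.ae_lintegral_addPoints_lt_top (hQ : IsPoissonLaw lam Q) (hp : Measurable p)
    (hp2 : MemLp (fun x => (p x : ℝ)) 2 Q) {ι : Type*} [Fintype ι] :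
    ∀ᵐ u ∂(Measure.pi fun _ : ι => lam), ∫⁻ x, p (addPoints x u) ∂Q < ∞ := by
  classical
  have := hQ.isProbabilityMeasure
  have hG : Measurable fun q : (ι → E) × Config E => (p q.2 : ℝ≥0∞) :=
    hp.coe_nnreal_ennreal.comp measurable_snd
  refine ae_lt_top (measurable_lintegral_addPoints (Q := Q) hG) ?_
  rw [← hQ.mecke_fintype hG]
  refine ne_top_of_le_ne_top (hQ.lintegral_pow_count_mul_ne_top hp hp2 (Fintype.card ι))
    (lintegral_mono fun x => ?_)
  simp only [Finset.sum_const, nsmul_eq_mul]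
  gcongr
  exact card_injTuples_le ι x

theorem IsPoissonLaw.lintegral_prod_uStatistic (hQ : IsPoissonLaw lam Q) (hp : Measurable p)
    {m : ℕ} {k : Fin m → ℕ} {f : (i : Fin m) → (Fin (k i) → E) → ℝ} (hf : ∀ i u, 0 ≤ f i u)
    {F : Fin m → Config E → ℝ} (hF : ∀ i, IsUStatistic lam (k i) (f i) (F i)) :
    ∫⁻ x, p x * ENNReal.ofReal (∏ i, F i x) ∂Q = ∑ σ ∈ diagramPartitions k,
      ∫⁻ v : {b // b ∈ σ.parts} → E, ENNReal.ofReal (contractedTensor f σ v) *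
        ∫⁻ x, p (addPoints x v) ∂Q ∂Measure.pi fun _ => lam := by
  have hG : ∀ σ : Finpartition (Finset.univ : Finset (Vars k)),
      Measurable fun q : ({b // b ∈ σ.parts} → E) × Config E =>
        ENNReal.ofReal (contractedTensor f σ q.1) * p q.2 := fun σ =>
    ((measurable_contractedTensor (fun i => (hF i).measurable) σ).comp
      measurable_fst).ennreal_ofReal.mul (hp.coe_nnreal_ennreal.comp measurable_snd)
  have hx : ∀ x, p x * ENNReal.ofReal (∏ i, F i x) = ∑ σ ∈ diagramPartitions k,
      ∑ v ∈ injTuples {b // b ∈ σ.parts} x,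
        ENNReal.ofReal (contractedTensor f σ v) * p x := by
    intro x
    simp_rw [fun i => (hF i).eq_sum x, prod_sum_distinctTuples]
    rw [ENNReal.ofReal_sum_of_nonneg fun σ _ =>
      Finset.sum_nonneg fun v _ => contractedTensor_nonneg hf σ v, Finset.mul_sum]
    refine Finset.sum_congr rfl fun σ _ => ?_
    rw [ENNReal.ofReal_sum_of_nonneg fun v _ => contractedTensor_nonneg hf σ v, Finset.mul_sum]
    exact Finset.sum_congr rfl fun v _ => mul_comm _ _
  simp_rw [hx]
  rw [lintegral_finsetSum _ fun σ _ => measurable_sum_injTuples_fintype (hG σ)]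
  refine Finset.sum_congr rfl fun σ _ => ?_
  rw [hQ.mecke_fintype (hG σ)]
  refine lintegral_congr fun v => ?_
  have hv : Measurable fun x => (p (addPoints x v) : ℝ≥0∞) :=
    (hp.comp (measurable_addPoints.comp (measurable_prodMk_right (y := v)))).coe_nnreal_ennreal
  exact lintegral_const_mul (ENNReal.ofReal (contractedTensor f σ v)) hv

end ProductMoments

end PointProcess

/-! ### The moment formula -/

open PointProcess in
theorem theorem3 {d : ℕ} (B : Set (EuclideanSpace ℝ (Fin d)))
    (hB : MeasurableSet B) (hBb : Bornology.IsBounded B) (hBpos : 0 < volume B)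
    (lam : Measure B) [IsFiniteMeasure lam] [NullSingletonClass lam]
    (Pη : Measure (PointProcess.Config B)) (hη : PointProcess.IsPoissonLaw lam Pη)
    (p : PointProcess.Config B → ℝ≥0) (hp : Measurable p)
    (hp1 : ∫⁻ x, (p x : ℝ≥0∞) ∂Pη = 1)
    (hher : PointProcess.Hereditary p)
    (hp2 : MemLp (fun x => (p x : ℝ)) 2 Pη)
    {Ω : Type*} [MeasurableSpace Ω] (P : Measure Ω) [IsProbabilityMeasure P]
    (μ : Ω → PointProcess.Config B)
    (hμ : HasLaw μ (Pη.withDensity fun x => (p x : ℝ≥0∞)) P)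
    (m : ℕ) (k : Fin m → ℕ)
    (f : (i : Fin m) → (Fin (k i) → B) → ℝ) (hf : ∀ i u, 0 ≤ f i u)
    (F : Fin m → PointProcess.Config B → ℝ)
    (hF : ∀ i, PointProcess.IsUStatistic lam (k i) (f i) (F i))
    (hF2 : MemLp (fun x => ∏ i, F i x) 2 Pη) :
    Integrable (fun ω => ∏ i, F i (μ ω)) P ∧
    (∀ σ ∈ PointProcess.diagramPartitions k,
      (∀ᵐ x ∂(Measure.pi fun _ : {b // b ∈ σ.parts} => lam),
        Integrable (fun ω => PointProcess.condIntensity p x (μ ω)) P) ∧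
      Integrable (fun x : {b // b ∈ σ.parts} → B =>
        PointProcess.contractedTensor f σ x *
          ∫ ω, PointProcess.condIntensity p x (μ ω) ∂P) (Measure.pi fun _ => lam)) ∧
    ∫ ω, ∏ i, F i (μ ω) ∂P =
      ∑ σ ∈ PointProcess.diagramPartitions k,
        ∫ x : {b // b ∈ σ.parts} → B,
          PointProcess.contractedTensor f σ x *
            ∫ ω, PointProcess.condIntensity p x (μ ω) ∂P ∂(Measure.pi fun _ => lam) := by
  have hprob := hη.isProbabilityMeasure
  have hFm : AEMeasurable (fun x => ∏ i, F i x) (Pη.withDensity fun x => (p x : ℝ≥0∞)) :=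
    hF2.1.aemeasurable.mono_ac (withDensity_absolutelyContinuous _ _)
  have hF0 : ∀ x, 0 ≤ ∏ i, F i x := fun x => Finset.prod_nonneg fun i _ => by
    rw [(hF i).eq_sum]
    exact Finset.sum_nonneg fun u _ => hf i u
  have hint : Integrable (fun x => ∏ i, F i x) (Pη.withDensity fun x => (p x : ℝ≥0∞)) :=
    (integrable_withDensity_iff_integrable_smul hp).2 (hp2.integrable_mul hF2)
  have hintP : Integrable (fun ω => ∏ i, F i (μ ω)) P := by
    rw [← hμ.map_eq] at hint
    exact hint.comp_aemeasurable hμ.aemeasurable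
  have hmain : ∫⁻ ω, ENNReal.ofReal (∏ i, F i (μ ω)) ∂P = ∑ σ ∈ diagramPartitions k,
      ∫⁻ v : {b // b ∈ σ.parts} → B, ENNReal.ofReal (contractedTensor f σ v) *
        ∫⁻ x, p (addPoints x v) ∂Pη ∂Measure.pi fun _ => lam := by
    rw [hμ.lintegral_comp (f := fun x => ENNReal.ofReal (∏ i, F i x)) hFm.ennreal_ofReal,
      lintegral_withDensity_eq_lintegral_mul₀ hp.coe_nnreal_ennreal.aemeasurable
        hF2.1.aemeasurable.ennreal_ofReal, ← hη.lintegral_prod_uStatistic hp hf hF]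
    rfl
  -- A finite sum in `ℝ≥0∞` has finite terms, so integrability of the product passes to each
  -- partition separately.
  have hterm : ∀ σ ∈ diagramPartitions k,
      ∫⁻ v : {b // b ∈ σ.parts} → B, ENNReal.ofReal (contractedTensor f σ v) *
        ∫⁻ x, p (addPoints x v) ∂Pη ∂(Measure.pi fun _ => lam) ≠ ∞ := by
    have h := (lintegral_ofReal_ne_top_iff_integrable hintP.aestronglyMeasurable
      (Filter.Eventually.of_forall fun ω => hF0 (μ ω))).2 hintP
    rw [hmain] at h
    exact fun σ hσ => (ENNReal.sum_ne_top.1 h) σ hσ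
  have hm : ∀ σ : Finpartition (Finset.univ : Finset (Vars k)),
      Measurable fun v : {b // b ∈ σ.parts} → B =>
        contractedTensor f σ v * ∫ ω, condIntensity p v (μ ω) ∂P := fun σ => by
    simp_rw [fun v : {b // b ∈ σ.parts} → B => integral_condIntensity_of_hasLaw hμ hp hher v]
    exact (measurable_contractedTensor (fun i => (hF i).measurable) σ).mul
      (measurable_lintegral_addPoints (Q := Pη)
        (G := fun q : ({b // b ∈ σ.parts} → B) × Config B => (p q.2 : ℝ≥0∞))
        (hp.coe_nnreal_ennreal.comp measurable_snd)).ennreal_toReal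
  have h0 : ∀ (σ : Finpartition (Finset.univ : Finset (Vars k))) (v : {b // b ∈ σ.parts} → B),
      0 ≤ contractedTensor f σ v * ∫ ω, condIntensity p v (μ ω) ∂P := fun σ v =>
    mul_nonneg (contractedTensor_nonneg hf σ v)
      (integral_nonneg fun ω => condIntensity_nonneg v (μ ω))
  -- The real-valued mean represents the `ℝ≥0∞`-valued one only where the latter is finite, that is,
  -- almost everywhere.
  have hlint : ∀ σ : Finpartition (Finset.univ : Finset (Vars k)),
      ∫⁻ v : {b // b ∈ σ.parts} → B, ENNReal.ofReal
        (contractedTensor f σ v * ∫ ω, condIntensity p v (μ ω) ∂P) ∂(Measure.pi fun _ => lam) =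
      ∫⁻ v : {b // b ∈ σ.parts} → B, ENNReal.ofReal (contractedTensor f σ v) *
        ∫⁻ x, p (addPoints x v) ∂Pη ∂(Measure.pi fun _ => lam) := fun σ => by
    refine lintegral_congr_ae ?_
    filter_upwards [hη.ae_lintegral_addPoints_lt_top hp hp2] with v hv
    rw [integral_condIntensity_of_hasLaw hμ hp hher v,
      ENNReal.ofReal_mul (contractedTensor_nonneg hf σ v), ENNReal.ofReal_toReal hv.ne]
  refine ⟨hintP, fun σ hσ => ⟨?_, ?_⟩, ?_⟩
  · filter_upwards [hη.ae_lintegral_addPoints_lt_top hp hp2] with v hv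
    refine (lintegral_ofReal_ne_top_iff_integrable
      ((measurable_condIntensity hp v).comp_aemeasurable hμ.aemeasurable).aestronglyMeasurable
      (Filter.Eventually.of_forall fun ω => condIntensity_nonneg v (μ ω))).1 ?_
    simp only [Function.comp_apply]
    rw [lintegral_condIntensity_of_hasLaw hμ hp hher v]
    exact hv.ne
  · rw [← lintegral_ofReal_ne_top_iff_integrable (hm σ).aestronglyMeasurable
      (Filter.Eventually.of_forall (h0 σ)), hlint]
    exact hterm σ hσ
  · rw [integral_eq_lintegral_of_nonneg_ae (Filter.Eventually.of_forall fun ω => hF0 (μ ω))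
      hintP.aestronglyMeasurable, hmain, ENNReal.toReal_sum hterm]
    refine Finset.sum_congr rfl fun σ _ => ?_
    rw [integral_eq_lintegral_of_nonneg_ae (Filter.Eventually.of_forall (h0 σ))
      (hm σ).aestronglyMeasurable, hlint]
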